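/- Let $H$ be a semisimple Hopf algebra over an algebraically closed field $k$ of characteristic $0$ (such an $H$ is automatically finite-dimensional), with comultiplication $\Delta(h)=\sum h_1\otimes h_2$ and antipode $S$; let $s$ be the antipode of the dual Hopf algebra $H^*$ and $Z(H)$ the center of the algebra $H$. Let $\mathrm{Irr}(H)\subset H^*$ be the (finite) set of characters of irreducible $H$-modules, put $$\chi_{ad}=\sum_{\chi\in \mathrm{Irr}(H)}\chi\, s(\chi)\in H^*,$$ let $H^*_{ad}$ be the Hopf subalgebra of $H^*$ generated by $\chi_{ad}$, and define $$\tilde Z(H)=H^{H^*_{ad}}=\Big\{h\in H \;:\; \sum h_1\langle b,h_2\rangle=\langle b,1\rangle h \ \text{ for all } b\in H^*_{ad}\Big\}.$$ Then $\tilde Z(H)$ is the Hopf center of $H$: it is a Hopf subalgebra of $H$ contained in $Z(H)$, and it contains every Hopf subalgebra of $H$ that is contained in $Z(H)$. Moreover, $\tilde Z(H)$ contains every left coideal $N$ of $H$ (a subspace with $\Delta(N)\subseteq H\otimes N$) and every right coideal $N$ of $H$ (a subspace with $\Delta(N)\subseteq N\otimes H$) that is contained in $Z(H)$. -/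

import Mathlib

open scoped TensorProduct

noncomputable section

namespace HopfCenter

open Coalgebra HopfAlgebra

universe u v

/-! ### Semisimple Hopf algebras are finite-dimensional -/

section FiniteDimensional

variable (k : Type u) (H : Type v) [Field k] [Ring H] [HopfAlgebra k H]

/-- A Hopf algebra whose underlying ring is semisimple has a normalized left integral. -/
theorem exists_integral [IsSemisimpleRing H] :
    ∃ t : H, counit (R := k) t = 1 ∧ ∀ h : H, h * t = counit (R := k) h • t := by
  obtain ⟨I, hI⟩ := exists_isCompl
    (RingHom.ker (Bialgebra.counitAlgHom k H : H →+* k) : Submodule H H)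
  have h1 : (1 : H) ∈ (RingHom.ker (Bialgebra.counitAlgHom k H : H →+* k) : Submodule H H) ⊔ I := by
    rw [hI.sup_eq_top]; trivial
  obtain ⟨p, hp, t, ht, hpt⟩ := Submodule.mem_sup.1 h1
  have hp' : counit (R := k) p = 0 := by simpa [RingHom.mem_ker] using hp
  have hε : counit (R := k) t = 1 := by
    have := congrArg (counit (R := k)) hpt
    simpa [hp'] using this
  refine ⟨t, hε, fun h => ?_⟩
  have hm : h * t - counit (R := k) h • t ∈
      (RingHom.ker (Bialgebra.counitAlgHom k H : H →+* k) : Submodule H H) ⊓ I := by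
    refine ⟨?_, ?_⟩
    · change _ ∈ RingHom.ker _
      simp [RingHom.mem_ker, hε]
    · refine I.sub_mem (I.smul_mem h ht) ?_
      rw [Algebra.smul_def]
      exact I.smul_mem _ ht
  rw [hI.inf_eq_bot] at hm
  exact sub_eq_zero.1 ((Submodule.mem_bot _).1 hm)

/-- A semisimple Hopf algebra over a field is finite-dimensional. -/
instance finite_of_isSemisimpleRing [IsSemisimpleRing H] : Module.Finite k H := by
  classical
  obtain ⟨t, ht1, ht⟩ := exists_integral k H
  set e : H ⊗[k] H := (antipode k (A := H)).lTensor H (comul t) with he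
  -- the functional calculus used to compare both sides
  let F : H ⊗[k] H →ₗ[k] H →ₗ[k] H ⊗[k] H :=
    LinearMap.mk₂ k (fun z c => (antipode k (A := H)).lTensor H (z * comul t) * (1 ⊗ₜ c))
      (by intros; simp [add_mul]) (by intros; simp)
      (by intros; simp [TensorProduct.tmul_add, mul_add]) (by intros; simp)
  have hF1 : ∀ h : H, TensorProduct.lift F ((comul (R := k) (A := H)).rTensor H (comul h))
      = e * (1 ⊗ₜ h) := by
    intro h
    rw [← (ℛ k h).eq]
    simp only [map_sum, LinearMap.rTensor_tmul, TensorProduct.lift.tmul]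
    have : ∀ i ∈ (ℛ k h).index, F (comul ((ℛ k h).left i)) ((ℛ k h).right i)
        = e * (1 ⊗ₜ (counit (R := k) ((ℛ k h).left i) • (ℛ k h).right i)) := by
      intro i _
      simp only [F, LinearMap.mk₂_apply]
      rw [← Bialgebra.comul_mul, ht]
      simp [he]
    rw [Finset.sum_congr rfl this, ← Finset.mul_sum, ← TensorProduct.tmul_sum,
      sum_counit_smul]
  have hF2 : ∀ h : H, TensorProduct.lift F ((TensorProduct.assoc k H H H).symm
      ((comul (R := k) (A := H)).lTensor H (comul h))) = (h ⊗ₜ 1) * e := by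
    intro h
    have key : ∀ (a : H) (w : H ⊗[k] H),
        TensorProduct.lift F ((TensorProduct.assoc k H H H).symm (a ⊗ₜ w)) =
        (a ⊗ₜ[k] (1 : H)) * ((LinearMap.mulRight k
          (LinearMap.mul' k H ((antipode k (A := H)).rTensor H w))).lTensor H e) := by
      intro a w
      induction w with
      | zero => simp
      | add x y hx hy =>
        rw [TensorProduct.tmul_add, map_add, map_add, hx, hy, ← mul_add]
        congr 1
        have : LinearMap.mulRight k (LinearMap.mul' k H ((antipode k (A := H)).rTensor H (x + y)))
          = LinearMap.mulRight k (LinearMap.mul' k H ((antipode k (A := H)).rTensor H x))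
          + LinearMap.mulRight k (LinearMap.mul' k H ((antipode k (A := H)).rTensor H y)) := by
          ext z; simp [mul_add]
        rw [this, LinearMap.lTensor_add, LinearMap.add_apply]
      | tmul b c =>
        simp only [TensorProduct.assoc_symm_tmul, TensorProduct.lift.tmul, F,
          LinearMap.mk₂_apply, he]
        rw [← (ℛ k t).eq]
        simp [Finset.mul_sum, Finset.sum_mul, antipode_mul_antidistrib, mul_assoc]
    rw [← (ℛ k h).eq]
    simp only [map_sum, LinearMap.lTensor_tmul, key, mul_antipode_rTensor_comul_apply]
    have h2 : ∀ i ∈ (ℛ k h).index, ((ℛ k h).left i ⊗ₜ[k] (1 : H)) * (LinearMap.mulRight k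
          (algebraMap k H (counit ((ℛ k h).right i)))).lTensor H e
        = ((counit (R := k) ((ℛ k h).right i) • (ℛ k h).left i) ⊗ₜ[k] (1 : H)) * e := by
      intro i _
      have : LinearMap.mulRight k (algebraMap k H (counit ((ℛ k h).right i)))
        = counit (R := k) ((ℛ k h).right i) • LinearMap.id := by
        ext z; simp [Algebra.algebraMap_eq_smul_one]
      rw [this, LinearMap.lTensor_smul, LinearMap.lTensor_id, LinearMap.smul_apply,
        LinearMap.id_apply, mul_smul_comm, ← TensorProduct.smul_tmul', smul_mul_assoc]
    rw [Finset.sum_congr rfl h2, ← Finset.sum_mul, ← TensorProduct.sum_tmul]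
    congr 2
    have := congrArg (TensorProduct.rid k H) (lTensor_counit_comul (R := k) h)
    have h5 : TensorProduct.rid k H ((counit (R := k) (A := H)).lTensor H
        (∑ i ∈ (ℛ k h).index, (ℛ k h).left i ⊗ₜ[k] (ℛ k h).right i)) = h := by
      rw [(ℛ k h).eq, this]
      simp
    simpa only [map_sum, LinearMap.lTensor_tmul, TensorProduct.rid_tmul] using h5
  have hcas : ∀ h : H, (h ⊗ₜ[k] (1 : H)) * e = e * (1 ⊗ₜ h) := by
    intro h
    rw [← hF1, ← hF2, Coalgebra.coassoc_symm_apply]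
  have hmul : LinearMap.mul' k H e = 1 := by
    rw [he, mul_antipode_lTensor_comul_apply, ht1, map_one]
  -- slices of `e` by functionals form a finite-dimensional left ideal
  let sl : (H →ₗ[k] k) →ₗ[k] H :=
    { toFun := fun φ => TensorProduct.rid k H (φ.lTensor H e)
      map_add' := by intros; simp [LinearMap.lTensor_add]
      map_smul' := by intros; simp [LinearMap.lTensor_smul] }
  have hslmul : ∀ (φ : H →ₗ[k] k) (a : H) (w : H ⊗[k] H),
      TensorProduct.rid k H (φ.lTensor H ((a ⊗ₜ[k] (1 : H)) * w))
        = a * TensorProduct.rid k H (φ.lTensor H w) := by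
    intro φ a w
    induction w with
    | zero => simp
    | add x y hx hy => simp only [mul_add, map_add, hx, hy]
    | tmul x y => simp
  have hslmul' : ∀ (φ : H →ₗ[k] k) (a : H) (w : H ⊗[k] H),
      TensorProduct.rid k H (φ.lTensor H (w * ((1 : H) ⊗ₜ[k] a)))
        = TensorProduct.rid k H ((φ ∘ₗ LinearMap.mulRight k a).lTensor H w) := by
    intro φ a w
    induction w with
    | zero => simp
    | add x y hx hy => simp only [add_mul, map_add, hx, hy]
    | tmul x y => simp
  have hideal : ∀ (a : H) (φ : H →ₗ[k] k), a * sl φ = sl (φ ∘ₗ LinearMap.mulRight k a) := by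
    intro a φ
    change a * TensorProduct.rid k H (φ.lTensor H e) = _
    rw [← hslmul, hcas, hslmul']
    rfl
  have hfin : Module.Finite k (LinearMap.range sl) := by
    obtain ⟨S, hS⟩ := TensorProduct.exists_finset e
    have hle : LinearMap.range sl ≤ Submodule.span k (Finset.image Prod.fst S : Finset H) := by
      rintro _ ⟨φ, rfl⟩
      change TensorProduct.rid k H (φ.lTensor H e) ∈ _
      rw [hS]
      simp only [map_sum, LinearMap.lTensor_tmul, TensorProduct.rid_tmul]
      refine Submodule.sum_mem _ fun i hi => Submodule.smul_mem _ _ (Submodule.subset_span ?_)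
      exact Finset.mem_coe.2 (Finset.mem_image_of_mem _ hi)
    exact Submodule.finiteDimensional_of_le hle
  let act : H →ₗ[k] (LinearMap.range sl →ₗ[k] H) :=
    { toFun := fun a => LinearMap.mulLeft k a ∘ₗ (LinearMap.range sl).subtype
      map_add' := by intros; ext; simp [add_mul]
      map_smul' := by intros; ext; simp }
  let act' : H →ₗ[k] (LinearMap.range sl →ₗ[k] LinearMap.range sl) :=
    { toFun := fun a => (act a).codRestrict _ (by
        rintro ⟨_, φ, rfl⟩
        exact ⟨_, (hideal a φ).symm⟩)
      map_add' := by intros; ext; simp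
      map_smul' := by intros; ext; simp }
  refine Module.Finite.of_injective act' ?_
  refine (injective_iff_map_eq_zero act').2 ?_
  intro a ha
  have hz : ∀ φ : H →ₗ[k] k, a * sl φ = 0 := by
    intro φ
    have := LinearMap.congr_fun ha ⟨sl φ, φ, rfl⟩
    exact congrArg Subtype.val this
  have hae : (a ⊗ₜ[k] (1 : H)) * e = 0 := by
    let b := Module.Basis.ofVectorSpace k H
    apply (TensorProduct.equivFinsuppOfBasisRight (M := H) b).injective
    ext i
    rw [TensorProduct.equivFinsuppOfBasisRight_apply, hslmul]
    exact hz (b.coord i)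
  have : ∀ w : H ⊗[k] H, LinearMap.mul' k H ((a ⊗ₜ[k] (1 : H)) * w)
      = a * LinearMap.mul' k H w := by
    intro w
    induction w with
    | zero => simp
    | add x y hx hy => simp only [mul_add, map_add, hx, hy]
    | tmul x y => simp [mul_assoc]
  have h3 := this e
  rw [hae, hmul] at h3
  simpa using h3.symm

end FiniteDimensional

/-! ### The dual Hopf algebra of a finite-dimensional Hopf algebra -/

section Dual

variable (k : Type u) (H : Type v) [Field k] [Ring H] [HopfAlgebra k H]

/-- The dual `H^*`, carrying the convolution product `⟨p * q, h⟩ = ∑ ⟨p, h₁⟩ ⟨q, h₂⟩`. -/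
def HDual : Type (max u v) := WithConv (H →ₗ[k] k)

instance : Ring (HDual k H) := inferInstanceAs (Ring (WithConv (H →ₗ[k] k)))

instance : Algebra k (HDual k H) := inferInstanceAs (Algebra k (WithConv (H →ₗ[k] k)))

/-- `H^*` as a space of linear functionals. -/
def toDual : HDual k H ≃ₗ[k] Module.Dual k H where
  toFun p := WithConv.ofConv p
  invFun f := WithConv.toConv f
  map_add' _ _ := rfl
  map_smul' _ _ := rfl
  left_inv _ := rfl
  right_inv _ := rfl

instance : FunLike (HDual k H) H k where
  coe p := toDual k H p
  coe_injective _ _ h := (toDual k H).injective (DFunLike.coe_injective h)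

instance : LinearMapClass (HDual k H) k H k where
  map_add p := (toDual k H p).map_add
  map_smulₛₗ p := (toDual k H p).map_smul

section Apply

variable {k H}

@[simp] theorem toDual_apply (p : HDual k H) (a : H) : toDual k H p a = p a := rfl

@[simp] theorem toDual_symm_apply (f : Module.Dual k H) (a : H) : (toDual k H).symm f a = f a := rfl

@[ext] theorem HDual.ext {p q : HDual k H} (h : ∀ a, p a = q a) : p = q := DFunLike.ext _ _ h

@[simp] theorem zero_apply (a : H) : (0 : HDual k H) a = 0 := rfl

@[simp] theorem add_apply (p q : HDual k H) (a : H) : (p + q) a = p a + q a := rfl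

@[simp] theorem smul_apply (c : k) (p : HDual k H) (a : H) : (c • p) a = c * p a := rfl

@[simp] theorem one_apply (a : H) : (1 : HDual k H) a = counit (R := k) a := rfl

theorem algebraMap_apply (c : k) (a : H) :
    algebraMap k (HDual k H) c a = c * counit (R := k) a := by
  rw [Algebra.algebraMap_eq_smul_one, smul_apply, one_apply]

@[simp] theorem mul_apply_one (p q : HDual k H) : (p * q) 1 = p 1 * q 1 := by
  change LinearMap.mul' k k (TensorProduct.map (toDual k H p) (toDual k H q) (comul 1)) = _
  simp [Algebra.TensorProduct.one_def]

theorem mul_apply {ι : Type*} {a : H} (r : Coalgebra.Repr k a ι) (p q : HDual k H) :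
    (p * q) a = ∑ i ∈ r.index, p (r.left i) * q (r.right i) :=
  r.convMul_apply (WithConv.toConv (toDual k H p)) (WithConv.toConv (toDual k H q))

end Apply

variable [Module.Finite k H]

/-- The identification `H^* ⊗ H^* ≃ (H ⊗ H)^*`, `(p ⊗ q) (a ⊗ b) = p a * q b`. -/
def dualTensorEquiv : HDual k H ⊗[k] HDual k H ≃ₗ[k] Module.Dual k (H ⊗[k] H) :=
  (TensorProduct.congr (toDual k H) (toDual k H)).trans (TensorProduct.dualDistribEquiv k H H)

@[simp] theorem dualTensorEquiv_tmul (p q : HDual k H) (a b : H) :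
    dualTensorEquiv k H (p ⊗ₜ q) (a ⊗ₜ b) = p a * q b := by
  simp [dualTensorEquiv, TensorProduct.dualDistribEquiv, TensorProduct.dualDistribEquivOfBasis]

/-- `Δ p` is the functional `a ⊗ b ↦ p (a * b)`, and the counit of `H^*` is `p ↦ p 1`. -/
instance : CoalgebraStruct k (HDual k H) where
  comul := (dualTensorEquiv k H).symm.toLinearMap ∘ₗ
    (LinearMap.mul' k H).dualMap ∘ₗ (toDual k H).toLinearMap
  counit := LinearMap.applyₗ (1 : H) ∘ₗ (toDual k H).toLinearMap

@[simp] theorem counit_dual (p : HDual k H) : counit (R := k) p = p 1 := rfl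

@[simp] theorem dualTensorEquiv_comul (p : HDual k H) (a b : H) :
    dualTensorEquiv k H (comul p) (a ⊗ₜ b) = p (a * b) := by
  simp [comul]

variable {k H} in
theorem dualTensor_ext {x y : HDual k H ⊗[k] HDual k H}
    (h : ∀ a b, dualTensorEquiv k H x (a ⊗ₜ b) = dualTensorEquiv k H y (a ⊗ₜ b)) : x = y := by
  apply (dualTensorEquiv k H).injective
  ext a b
  exact h a b

/-- The identification `H^* ⊗ (H^* ⊗ H^*) ≃ (H ⊗ (H ⊗ H))^*`. -/
def dualTensorEquiv₃ :
    HDual k H ⊗[k] (HDual k H ⊗[k] HDual k H) ≃ₗ[k] Module.Dual k (H ⊗[k] (H ⊗[k] H)) :=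
  (TensorProduct.congr (toDual k H) (dualTensorEquiv k H)).trans
    (TensorProduct.dualDistribEquiv k H (H ⊗[k] H))

@[simp] theorem dualTensorEquiv₃_tmul (p : HDual k H) (z : HDual k H ⊗[k] HDual k H)
    (a : H) (w : H ⊗[k] H) :
    dualTensorEquiv₃ k H (p ⊗ₜ z) (a ⊗ₜ w) = p a * dualTensorEquiv k H z w := by
  simp [dualTensorEquiv₃, TensorProduct.dualDistribEquiv, TensorProduct.dualDistribEquivOfBasis]

instance : Coalgebra k (HDual k H) where
  coassoc := by
    ext p : 1
    apply (dualTensorEquiv₃ k H).injective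
    ext a b c
    have h1 : ∀ t : HDual k H ⊗[k] HDual k H,
        dualTensorEquiv₃ k H ((comul (R := k) (A := HDual k H)).lTensor _ t) (a ⊗ₜ (b ⊗ₜ c))
          = dualTensorEquiv k H t (a ⊗ₜ (b * c)) := by
      intro t
      induction t with
      | zero => simp
      | add x y hx hy => simp only [map_add, LinearMap.add_apply, hx, hy]
      | tmul x y => simp
    have h0 : ∀ (z : HDual k H ⊗[k] HDual k H) (q : HDual k H),
        dualTensorEquiv₃ k H (TensorProduct.assoc k _ _ _ (z ⊗ₜ q)) (a ⊗ₜ (b ⊗ₜ c))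
          = dualTensorEquiv k H z (a ⊗ₜ b) * q c := by
      intro z q
      induction z with
      | zero => simp
      | add x y hx hy =>
        simp only [TensorProduct.add_tmul, map_add, LinearMap.add_apply, hx, hy, add_mul]
      | tmul x y => simp [mul_assoc]
    have h2 : ∀ t : HDual k H ⊗[k] HDual k H,
        dualTensorEquiv₃ k H (TensorProduct.assoc k _ _ _
          ((comul (R := k) (A := HDual k H)).rTensor _ t)) (a ⊗ₜ (b ⊗ₜ c))
          = dualTensorEquiv k H t ((a * b) ⊗ₜ c) := by
      intro t
      induction t with
      | zero => simp
      | add x y hx hy => simp only [map_add, LinearMap.add_apply, hx, hy]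
      | tmul x y => simp [h0]
    change dualTensorEquiv₃ k H (TensorProduct.assoc k _ _ _
          ((comul (R := k) (A := HDual k H)).rTensor _ (comul p))) (a ⊗ₜ (b ⊗ₜ c)) =
      dualTensorEquiv₃ k H ((comul (R := k) (A := HDual k H)).lTensor _ (comul p)) (a ⊗ₜ (b ⊗ₜ c))
    rw [h1, h2, dualTensorEquiv_comul, dualTensorEquiv_comul, mul_assoc]
  rTensor_counit_comp_comul := by
    ext p : 1
    apply (TensorProduct.lid k (HDual k H)).injective
    ext a
    have h : ∀ t : HDual k H ⊗[k] HDual k H,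
        TensorProduct.lid k (HDual k H) ((counit (R := k) (A := HDual k H)).rTensor _ t) a
          = dualTensorEquiv k H t (1 ⊗ₜ a) := by
      intro t
      induction t with
      | zero => simp
      | add x y hx hy => simp_all
      | tmul x y => simp
    simpa using h (comul p)
  lTensor_counit_comp_comul := by
    ext p : 1
    apply (TensorProduct.rid k (HDual k H)).injective
    ext a
    have h : ∀ t : HDual k H ⊗[k] HDual k H,
        TensorProduct.rid k (HDual k H) ((counit (R := k) (A := HDual k H)).lTensor _ t) a
          = dualTensorEquiv k H t (a ⊗ₜ 1) := by
      intro t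
      induction t with
      | zero => simp
      | add x y hx hy => simp_all
      | tmul x y => simp [mul_comm]
    simpa using h (comul p)

theorem dualTensorEquiv_mul (x y : HDual k H ⊗[k] HDual k H) (a b : H) :
    dualTensorEquiv k H (x * y) (a ⊗ₜ b) = ∑ i ∈ (ℛ k a).index, ∑ j ∈ (ℛ k b).index,
      dualTensorEquiv k H x ((ℛ k a).left i ⊗ₜ (ℛ k b).left j) *
      dualTensorEquiv k H y ((ℛ k a).right i ⊗ₜ (ℛ k b).right j) := by
  induction x with
  | zero => simp
  | add x x' hx hx' =>
    simp only [add_mul, map_add, LinearMap.add_apply, hx, hx', Finset.sum_add_distrib]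
  | tmul p q =>
    induction y with
    | zero => simp
    | add y y' hy hy' =>
      simp only [mul_add, map_add, LinearMap.add_apply, hy, hy', Finset.sum_add_distrib]
    | tmul p' q' =>
      simp only [Algebra.TensorProduct.tmul_mul_tmul, dualTensorEquiv_tmul,
        mul_apply (ℛ k a), mul_apply (ℛ k b), Finset.sum_mul_sum]
      exact Finset.sum_congr rfl fun i _ => Finset.sum_congr rfl fun j _ => by ring

instance : Bialgebra k (HDual k H) :=
  Bialgebra.mk' k (HDual k H)
    (by simp)
    (by intro p q; simp)
    (by
      apply dualTensor_ext
      intro a b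
      rw [dualTensorEquiv_comul, Algebra.TensorProduct.one_def, dualTensorEquiv_tmul]
      simp)
    (by
      intro p q
      apply dualTensor_ext
      intro a b
      rw [dualTensorEquiv_comul, dualTensorEquiv_mul,
        mul_apply ((ℛ k a).mul (ℛ k b))]
      simp [Finset.sum_product])

/-- The antipode of `H^*` is `p ↦ p ∘ S`. -/
instance : HopfAlgebra k (HDual k H) where
  antipode := (toDual k H).symm.toLinearMap ∘ₗ
    (antipode k (A := H)).dualMap ∘ₗ (toDual k H).toLinearMap
  mul_antipode_rTensor_comul := by
    ext p a
    have h : ∀ t : HDual k H ⊗[k] HDual k H,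
        (LinearMap.mul' k (HDual k H) (((toDual k H).symm.toLinearMap ∘ₗ
          (antipode k (A := H)).dualMap ∘ₗ
          (toDual k H).toLinearMap).rTensor _ t)) a
        = ∑ i ∈ (ℛ k a).index,
          dualTensorEquiv k H t (antipode k ((ℛ k a).left i) ⊗ₜ (ℛ k a).right i) := by
      intro t
      induction t with
      | zero => simp
      | add x y hx hy =>
        simp only [map_add, add_apply, LinearMap.add_apply, hx, hy, Finset.sum_add_distrib]
      | tmul x y => 
        simp only [LinearMap.rTensor_tmul, LinearMap.mul'_apply, mul_apply (ℛ k a),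
          dualTensorEquiv_tmul]
        rfl
    refine (h (comul p)).trans ?_
    simp only [dualTensorEquiv_comul, ← map_sum p, sum_antipode_mul_eq_smul, map_smul, LinearMap.comp_apply,
      Algebra.linearMap_apply, counit_dual, algebraMap_apply, smul_eq_mul]
    exact mul_comm _ _
  mul_antipode_lTensor_comul := by
    ext p a
    have h : ∀ t : HDual k H ⊗[k] HDual k H,
        (LinearMap.mul' k (HDual k H) (((toDual k H).symm.toLinearMap ∘ₗ
          (antipode k (A := H)).dualMap ∘ₗ
          (toDual k H).toLinearMap).lTensor _ t)) a
        = ∑ i ∈ (ℛ k a).index,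
          dualTensorEquiv k H t ((ℛ k a).left i ⊗ₜ antipode k ((ℛ k a).right i)) := by
      intro t
      induction t with
      | zero => simp
      | add x y hx hy =>
        simp only [map_add, add_apply, LinearMap.add_apply, hx, hy, Finset.sum_add_distrib]
      | tmul x y =>
        simp only [LinearMap.lTensor_tmul, LinearMap.mul'_apply, mul_apply (ℛ k a),
          dualTensorEquiv_tmul]
        rfl
    refine (h (comul p)).trans ?_
    simp only [dualTensorEquiv_comul, ← map_sum p, sum_mul_antipode_eq_smul, map_smul, LinearMap.comp_apply,
      Algebra.linearMap_apply, counit_dual, algebraMap_apply, smul_eq_mul]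
    exact mul_comm _ _

end Dual

/-! ### Hopf subalgebras and coideals -/

section Sub

variable {k : Type u} {A : Type v} [Field k] [Ring A] [HopfAlgebra k A]

/-- The image of `M ⊗ N` in `A ⊗ A`, for subspaces `M`, `N` of `A`. -/
def tensorSub (M N : Submodule k A) : Submodule k (A ⊗[k] A) :=
  LinearMap.range (TensorProduct.map M.subtype N.subtype)

/-- A Hopf subalgebra: a subalgebra `B` with `Δ B ⊆ B ⊗ B` and `S B ⊆ B`. -/
structure IsHopfSubalgebra (B : Submodule k A) : Prop where
  one_mem : (1 : A) ∈ B
  mul_mem : ∀ {x y : A}, x ∈ B → y ∈ B → x * y ∈ B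
  comul_mem : ∀ {x : A}, x ∈ B → comul (R := k) x ∈ tensorSub B B
  antipode_mem : ∀ {x : A}, x ∈ B → antipode k x ∈ B

/-- A left coideal: a subspace `N` with `Δ N ⊆ A ⊗ N`. -/
def IsLeftCoideal (N : Submodule k A) : Prop :=
  ∀ x ∈ N, comul (R := k) x ∈ tensorSub ⊤ N

/-- A right coideal: a subspace `N` with `Δ N ⊆ N ⊗ A`. -/
def IsRightCoideal (N : Submodule k A) : Prop :=
  ∀ x ∈ N, comul (R := k) x ∈ tensorSub N ⊤

variable (k) in
/-- The Hopf subalgebra generated by a set: the intersection of all Hopf subalgebras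
containing it. -/
def hopfClosure (s : Set A) : Submodule k A :=
  sInf {B | IsHopfSubalgebra B ∧ s ⊆ B}

end Sub

/-! ### Irreducible characters, `H^*_ad` and its invariants -/

section Center

variable (k : Type u) (H : Type v) [Field k] [Ring H] [HopfAlgebra k H]

/-- The character `h ↦ tr (h | V)` of an `H`-module `V`. -/
def character (V : Type v) [AddCommGroup V] [Module k V] [Module H V] [IsScalarTower k H V] :
    HDual k H :=
  (toDual k H).symm (LinearMap.trace k V ∘ₗ (Algebra.lsmul k k V : H →ₐ[k] Module.End k V).toLinearMap)

/-- `Irr(H)`: the set of characters of irreducible `H`-modules. -/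
def Irr : Set (HDual k H) :=
  {χ | ∃ (V : Type v) (_ : AddCommGroup V) (_ : Module k V) (_ : Module H V)
    (_ : IsScalarTower k H V), IsSimpleModule H V ∧ χ = character k H V}

theorem character_congr (V W : Type v) [AddCommGroup V] [Module k V] [Module H V]
    [IsScalarTower k H V] [AddCommGroup W] [Module k W] [Module H W] [IsScalarTower k H W]
    (e : V ≃ₗ[H] W) : character k H V = character k H W := by
  ext h
  have : (Algebra.lsmul k k W h : Module.End k W)
      = (e.restrictScalars k).conj (Algebra.lsmul k k V h) := by
    ext w
    simp [LinearEquiv.conj_apply]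
  change LinearMap.trace k V (Algebra.lsmul k k V h) = LinearMap.trace k W (Algebra.lsmul k k W h)
  rw [this, LinearMap.trace_conj']

/-- There are finitely many irreducible characters, so that sums over `Irr(H)` make sense. -/
theorem Irr_finite [IsSemisimpleRing H] : (Irr k H).Finite := by
  classical
  have hs : ∀ c : isotypicComponents H H, ∃ S : Submodule H H, IsSimpleModule H S ∧
      c.1 = isotypicComponent H H S := by
    rintro ⟨c, S, hS, rfl⟩
    exact ⟨S, hS, rfl⟩
  choose S hS hc using hs
  refine (Set.finite_range fun c => character k H (S c)).subset ?_
  rintro _ ⟨V, _, _, _, _, hV, rfl⟩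
  obtain ⟨I, ⟨e⟩⟩ := IsSemisimpleRing.exists_linearEquiv_ideal_of_isSimpleModule H V
  have hI : IsSimpleModule H I := IsSimpleModule.congr e.symm
  let c : isotypicComponents H H := ⟨isotypicComponent H H I, I, hI, rfl⟩
  refine ⟨c, ?_⟩
  have hle : S c ≤ c.1 := by
    rw [hc c]
    exact Submodule.le_isotypicComponent (S c)
  have hle' : I ≤ c.1 := Submodule.le_isotypicComponent I
  have hSc := hS c
  obtain ⟨e'⟩ := (isIsotypicOfType_submodule_iff.1
    (isIsotypic_submodule_iff.1 (IsIsotypic.isotypicComponents c.2) I hle')) (S c) hle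
  exact character_congr k H (S c) V (e'.trans e.symm)

variable [Module.Finite k H]

/-- `χ_ad = ∑_{χ ∈ Irr(H)} χ s(χ)`, where `s` is the antipode of `H^*`. -/
def chiAd : HDual k H := ∑ᶠ χ ∈ Irr k H, χ * antipode k χ

/-- `H^*_ad`: the Hopf subalgebra of `H^*` generated by `χ_ad`. -/
def dualAd : Submodule k (HDual k H) := hopfClosure k {chiAd k H}

variable {k H} in
/-- The left hit action of `H^*` on `H`: `p ⇀ h = ∑ ⟨p, h₂⟩ h₁`. -/
def leftHit (p : HDual k H) : H →ₗ[k] H :=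
  (TensorProduct.rid k H).toLinearMap ∘ₗ (toDual k H p).lTensor H ∘ₗ comul

variable {k H} in
/-- `H^T = {h | p ⇀ h = ⟨p, 1⟩ h for all p ∈ T}`. -/
def hitInvariants (T : Submodule k (HDual k H)) : Submodule k H where
  carrier := {h | ∀ p ∈ T, leftHit p h = p 1 • h}
  add_mem' := by
    intro a b ha hb p hp
    rw [map_add, ha p hp, hb p hp, smul_add]
  zero_mem' := by intro p _; simp
  smul_mem' := by
    intro c a ha p hp
    rw [map_smul, ha p hp, smul_comm]

/-- `Z̃(H) = H^{H^*_ad}`. -/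
def tildeZ : Submodule k H := hitInvariants (dualAd k H)

end Center

end HopfCenter

end

noncomputable section
namespace HopfCenter
open Coalgebra HopfAlgebra
universe u v

/-! ### Membership in tensor products of subspaces, tested by slices. -/

section Slices

variable {k : Type u} {A : Type v} [Field k] [Ring A] [HopfAlgebra k A]

/-! Let K = `centralComul` be the set of h with Δ(h) central in H ⊗ H. It is a Hopf subalgebra
inside the center, and it contains every central one-sided coideal: one leg of Δ(h) is then central,
and `mem_centralComul_of_right` or `mem_centralComul_of_left` handles the other. So everything
reduces to `tildeZ_eq_centralComul`.

K ⊆ Z̃(H): by Schur, the legs of Δ(l), for l in K, act by scalars on a simple V, so l acts on End V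
through the counit. As χ s(χ) is the character of End V, χ_ad lies in the Hopf subalgebra of
functionals killing H K⁺, which therefore contains H^*_ad. This makes elements of K invariant.

Z̃(H) ⊆ K: let C be a subcoalgebra of H^* containing χ_ad. Its annihilator is a left ideal He with e
idempotent. Then χ_ad(e) = 0 is a sum of ranks of idempotents, so in characteristic 0 each rank
vanishes and e acts as zero under the adjoint action. Hence all matrix coefficients of the adjoint
representation lie in C (`adjointCoeff_mem`), and so in H^*_ad. Invariance under them gives ∑ h₁ ⊗
ad(h₂)y = h ⊗ y, which forces h to be central. Since Z̃(H) is a left coideal, it lies in K. -/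

theorem tensorSub_induction {M N : Submodule k A} {p : A ⊗[k] A → Prop} {x : A ⊗[k] A}
    (hx : x ∈ tensorSub M N) (tmul : ∀ m ∈ M, ∀ n ∈ N, p (m ⊗ₜ n))
    (add : ∀ y z, p y → p z → p (y + z)) : p x := by
  obtain ⟨t, rfl⟩ := hx
  induction t with
  | zero => simpa using tmul 0 M.zero_mem 0 N.zero_mem
  | add a b ha hb => rw [map_add]; exact add _ _ ha hb
  | tmul a b => exact tmul _ a.2 _ b.2

theorem tensorSub_mono {M M' N N' : Submodule k A} (hM : M ≤ M') (hN : N ≤ N') :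
    tensorSub M N ≤ tensorSub M' N' := fun _ hx =>
  tensorSub_induction hx (fun m hm n hn => ⟨⟨m, hM hm⟩ ⊗ₜ ⟨n, hN hn⟩, rfl⟩)
    fun _ _ => Submodule.add_mem _

theorem mem_tensorSub_top (x : A ⊗[k] A) : x ∈ tensorSub (⊤ : Submodule k A) ⊤ := by
  induction x with
  | zero => exact Submodule.zero_mem _
  | add a b ha hb => exact Submodule.add_mem _ ha hb
  | tmul a b => exact ⟨⟨a, trivial⟩ ⊗ₜ ⟨b, trivial⟩, rfl⟩

/-- The slice `(f ⊗ id) x`. -/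
def sliceLeft (f : Module.Dual k A) : A ⊗[k] A →ₗ[k] A :=
  (TensorProduct.lid k A).toLinearMap ∘ₗ f.rTensor A

/-- The slice `(id ⊗ f) x`. -/
def sliceRight (f : Module.Dual k A) : A ⊗[k] A →ₗ[k] A :=
  (TensorProduct.rid k A).toLinearMap ∘ₗ f.lTensor A

@[simp] theorem sliceLeft_tmul (f : Module.Dual k A) (a b : A) :
    sliceLeft f (a ⊗ₜ b) = f a • b := by simp [sliceLeft]

@[simp] theorem sliceRight_tmul (f : Module.Dual k A) (a b : A) :
    sliceRight f (a ⊗ₜ b) = f b • a := by simp [sliceRight]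

theorem ext_sliceRight {x y : A ⊗[k] A} (h : ∀ f, sliceRight f x = sliceRight f y) : x = y := by
  classical
  let b := Module.Basis.ofVectorSpace k A
  apply (TensorProduct.equivFinsuppOfBasisRight (M := A) b).injective
  ext i
  rw [TensorProduct.equivFinsuppOfBasisRight_apply, TensorProduct.equivFinsuppOfBasisRight_apply]
  exact h (b.coord i)

theorem ext_sliceLeft {x y : A ⊗[k] A} (h : ∀ f, sliceLeft f x = sliceLeft f y) : x = y := by
  classical
  let b := Module.Basis.ofVectorSpace k A
  apply (TensorProduct.equivFinsuppOfBasisLeft (N := A) b).injective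
  ext i
  rw [TensorProduct.equivFinsuppOfBasisLeft_apply, TensorProduct.equivFinsuppOfBasisLeft_apply]
  exact h (b.coord i)

theorem sliceLeft_map (f : Module.Dual k A) (g : A →ₗ[k] A) (x : A ⊗[k] A) :
    sliceLeft f (g.lTensor A x) = g (sliceLeft f x) := by
  induction x with
  | zero => simp
  | add a b ha hb => simp only [map_add, ha, hb]
  | tmul a b => simp

theorem sliceRight_map (f : Module.Dual k A) (g : A →ₗ[k] A) (x : A ⊗[k] A) :
    sliceRight f (g.rTensor A x) = g (sliceRight f x) := by
  induction x with
  | zero => simp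
  | add a b ha hb => simp only [map_add, ha, hb]
  | tmul a b => simp

/-- Linear projections onto M and N, applied to the two legs, fix x because they fix all its slices.
-/
theorem mem_tensorSub {M N : Submodule k A} {x : A ⊗[k] A}
    (hM : ∀ f, sliceRight f x ∈ M) (hN : ∀ f, sliceLeft f x ∈ N) : x ∈ tensorSub M N := by
  obtain ⟨P, hP⟩ := M.subtype.exists_leftInverse_of_injective M.ker_subtype
  obtain ⟨Q, hQ⟩ := N.subtype.exists_leftInverse_of_injective N.ker_subtype
  have hP' : (M.subtype ∘ₗ P).rTensor A x = x := ext_sliceRight fun f => by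
    rw [sliceRight_map]
    exact congrArg Subtype.val (LinearMap.congr_fun hP ⟨_, hM f⟩)
  have hQ' : (N.subtype ∘ₗ Q).lTensor A x = x := ext_sliceLeft fun f => by
    rw [sliceLeft_map]
    exact congrArg Subtype.val (LinearMap.congr_fun hQ ⟨_, hN f⟩)
  refine ⟨TensorProduct.map P Q x, ?_⟩
  rw [← LinearMap.comp_apply, ← TensorProduct.map_comp]
  conv_rhs => rw [← hP', ← hQ']
  rw [← LinearMap.comp_apply, LinearMap.rTensor_comp_lTensor]

end Slices

/-! ### Antipodes and convolution inverses in finite dimension. -/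

section Antipode

/-- Left multiplication by x is injective on the finite-dimensional S, hence surjective; the
resulting right inverse in S must equal y. -/
theorem mem_subalgebra_of_leftInverse {k A : Type*} [Field k] [Ring A] [Algebra k A]
    [Module.Finite k A] (S : Subalgebra k A) {x y : A} (hx : x ∈ S)
    (hyx : y * x = 1) : y ∈ S := by
  have hinj : Function.Injective (LinearMap.mulLeft k (⟨x, hx⟩ : S)) := by
    intro a b hab
    have h : x * (a : A) = x * b := congrArg Subtype.val hab
    have := congrArg (y * ·) h
    simp only [← mul_assoc, hyx, one_mul] at this
    exact Subtype.ext this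
  obtain ⟨z, hz⟩ := LinearMap.injective_iff_surjective.1 hinj 1
  have hz' : x * (z : A) = 1 := congrArg Subtype.val hz
  have : y = z := by
    rw [← mul_one y, ← hz', ← mul_assoc, hyx, one_mul]
  rw [this]
  exact z.2

variable {k : Type u} {A : Type v} [Field k] [Ring A] [HopfAlgebra k A]

/-- The linear endomorphisms mapping a subcoalgebra `C` to a subalgebra `D`, as a subalgebra of
the convolution algebra. -/
def convMaps (C D : Submodule k A) (hC : ∀ x ∈ C, comul (R := k) x ∈ tensorSub C C)
    (h1 : 1 ∈ D) (hmul : ∀ x ∈ D, ∀ y ∈ D, x * y ∈ D) :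
    Subalgebra k (WithConv (A →ₗ[k] A)) where
  carrier := {f | ∀ x ∈ C, f x ∈ D}
  mul_mem' := by
    intro f g hf hg x hx
    rw [LinearMap.convMul_apply]
    refine tensorSub_induction (p := fun t => LinearMap.mul' k A
      (TensorProduct.map f.ofConv g.ofConv t) ∈ D) (hC x hx) ?_ ?_
    · intro m hm n hn
      simpa using hmul _ (hf m hm) _ (hg n hn)
    · intro y z hy hz
      simpa using D.add_mem hy hz
  add_mem' := fun {f g} hf hg x hx => D.add_mem (hf x hx) (hg x hx)
  algebraMap_mem' := by
    intro c x hx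
    rw [Algebra.algebraMap_eq_smul_one]
    change c • (1 : WithConv (A →ₗ[k] A)) x ∈ D
    rw [LinearMap.convOne_apply, Algebra.algebraMap_eq_smul_one]
    exact D.smul_mem _ (D.smul_mem _ h1)

variable [Module.Finite k A]

instance : Module.Finite k (WithConv (A →ₗ[k] A)) :=
  Module.Finite.equiv (WithConv.linearEquiv k (A →ₗ[k] A)).symm

/-- A finite-dimensional subbialgebra of a Hopf algebra is stable under the antipode. -/
theorem antipode_mem_of_subbialgebra {B : Submodule k A}
    (hB : ∀ x ∈ B, comul (R := k) x ∈ tensorSub B B) (h1 : 1 ∈ B)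
    (hmul : ∀ x ∈ B, ∀ y ∈ B, x * y ∈ B) {x : A} (hx : x ∈ B) : antipode k x ∈ B :=
  -- The identity preserves B, and the antipode is its convolution inverse.
  mem_subalgebra_of_leftInverse (convMaps B B hB h1 hmul)
    (x := WithConv.toConv LinearMap.id) (y := WithConv.toConv (antipode k (A := A)))
    (fun _ h => h) LinearMap.antipode_mul_id x hx

variable (k A) in
/-- The antipode of a finite-dimensional Hopf algebra is bijective. -/
theorem antipode_injective : Function.Injective (antipode k (A := A)) := by
  refine LinearMap.injective_iff_surjective.2 fun x => ?_
  -- The roles are swapped: S maps into its own range, which is a subalgebra, so its convolution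
  -- inverse, the identity, does too. This gives surjectivity.
  refine mem_subalgebra_of_leftInverse
    (convMaps ⊤ (LinearMap.range (antipode k (A := A))) (fun x _ => mem_tensorSub_top _)
      ⟨1, antipode_one⟩ ?_)
    (x := WithConv.toConv (antipode k (A := A))) (y := WithConv.toConv LinearMap.id)
    (fun y _ => ⟨y, rfl⟩) LinearMap.id_mul_antipode x trivial
  rintro _ ⟨a, rfl⟩ _ ⟨b, rfl⟩
  exact ⟨b * a, antipode_mul_antidistrib b a⟩

end Antipode

/-! ### The Hopf subalgebra of elements with central comultiplication. -/

section CentralComul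

variable {k : Type u} {H : Type v} [Field k] [Ring H] [HopfAlgebra k H]

theorem commute_comul_of_central {h : H} (hh : ∀ x, Commute h x) (x : H) :
    Commute (comul (R := k) h) (comul x) := by
  change _ * _ = _ * _
  rw [← Bialgebra.comul_mul, ← Bialgebra.comul_mul, hh x]

/-- By coassociativity the left side is ∑ x₁ ⊗ x₂ S(x₃), which collapses. -/
theorem sum_comul_mul_antipode (x : H) :
    ∑ i ∈ (ℛ k x).index, comul (R := k) ((ℛ k x).left i) * (1 ⊗ₜ antipode k ((ℛ k x).right i))
      = x ⊗ₜ[k] (1 : H) := by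
  let F : H ⊗[k] (H ⊗[k] H) →ₗ[k] H ⊗[k] H :=
    (LinearMap.mul' k H ∘ₗ (antipode k (A := H)).lTensor H).lTensor H
  have h1 : ∀ (w : H ⊗[k] H) (c : H), F (TensorProduct.assoc k H H H (w ⊗ₜ c))
      = w * (1 ⊗ₜ antipode k c) := by
    intro w c
    induction w with
    | zero => simp
    | add a b ha hb => simp only [TensorProduct.add_tmul, map_add, ha, hb, add_mul]
    | tmul a b => simp [F]
  have h2 := congrArg F (coassoc_apply (R := k) x)
  have h3 : F ((comul (R := k) (A := H)).lTensor H (comul x)) = x ⊗ₜ 1 := by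
    simp only [F]
    rw [← LinearMap.comp_apply, ← LinearMap.lTensor_comp, LinearMap.comp_assoc,
      mul_antipode_lTensor_comul, LinearMap.lTensor_comp, LinearMap.comp_apply,
      lTensor_counit_comul]
    simp
  rw [h3] at h2
  rw [← h2]
  conv_rhs => rw [← (ℛ k x).eq]
  simp [h1]

theorem sum_antipode_mul_comul (x : H) :
    ∑ i ∈ (ℛ k x).index, (antipode k ((ℛ k x).left i) ⊗ₜ 1) * comul (R := k) ((ℛ k x).right i)
      = (1 : H) ⊗ₜ[k] x := by
  let F : (H ⊗[k] H) ⊗[k] H →ₗ[k] H ⊗[k] H :=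
    (LinearMap.mul' k H ∘ₗ (antipode k (A := H)).rTensor H).rTensor H
  have h1 : ∀ (w : H ⊗[k] H) (c : H), F ((TensorProduct.assoc k H H H).symm (c ⊗ₜ w))
      = (antipode k c ⊗ₜ 1) * w := by
    intro w c
    induction w with
    | zero => simp
    | add a b ha hb => simp only [TensorProduct.tmul_add, map_add, ha, hb, mul_add]
    | tmul a b => simp [F]
  have h2 := congrArg F (coassoc_symm_apply (R := k) x)
  have h3 : F ((comul (R := k) (A := H)).rTensor H (comul x)) = 1 ⊗ₜ x := by
    simp only [F]
    rw [← LinearMap.comp_apply, ← LinearMap.rTensor_comp, LinearMap.comp_assoc,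
      mul_antipode_rTensor_comul, LinearMap.rTensor_comp, LinearMap.comp_apply,
      rTensor_counit_comul]
    simp
  rw [h3] at h2
  rw [← h2]
  conv_rhs => rw [← (ℛ k x).eq]
  simp [h1]

/-- x ⊗ 1 is a sum of products Δ(x₁)(1 ⊗ S(x₂)), and Δ(h) commutes with both factors. -/
theorem commute_comul_left {h : H} (hh : ∀ x, Commute h x)
    (hr : ∀ y, Commute (comul (R := k) h) (1 ⊗ₜ y)) (x : H) :
    Commute (comul (R := k) h) (x ⊗ₜ 1) := by
  rw [← sum_comul_mul_antipode]
  exact Commute.sum_right _ _ _ fun i _ => (commute_comul_of_central hh _).mul_right (hr _)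

theorem commute_comul_right {h : H} (hh : ∀ x, Commute h x)
    (hl : ∀ y, Commute (comul (R := k) h) (y ⊗ₜ 1)) (x : H) :
    Commute (comul (R := k) h) (1 ⊗ₜ x) := by
  rw [← sum_antipode_mul_comul]
  exact Commute.sum_right _ _ _ fun i _ => (hl _).mul_right (commute_comul_of_central hh _)

theorem central_of_commute_comul_right {h : H}
    (hr : ∀ y, Commute (comul (R := k) h) (1 ⊗ₜ y)) (x : H) : Commute h x := by
  have key := congrArg (sliceLeft (counit (R := k) (A := H))) (hr x).eq
  have e1 : ∀ t : H ⊗[k] H, sliceLeft (counit (R := k)) (t * (1 ⊗ₜ x))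
      = sliceLeft (counit (R := k)) t * x := by
    intro t
    induction t with
    | zero => simp
    | add a b ha hb => simp only [add_mul, map_add, ha, hb]
    | tmul a b => simp
  have e2 : ∀ t : H ⊗[k] H, sliceLeft (counit (R := k)) ((1 ⊗ₜ x) * t)
      = x * sliceLeft (counit (R := k)) t := by
    intro t
    induction t with
    | zero => simp
    | add a b ha hb => simp only [mul_add, map_add, ha, hb]
    | tmul a b => simp
  have e3 : sliceLeft (counit (R := k)) (comul (R := k) h) = h := by
    simp [sliceLeft]
  rwa [e1, e2, e3] at key

variable (k H) in
/-- The elements whose comultiplication is central in `H ⊗ H`. -/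
def centralComul : Submodule k H where
  carrier := {h | ∀ z : H ⊗[k] H, Commute (comul (R := k) h) z}
  add_mem' := fun ha hb z => by rw [map_add]; exact (ha z).add_left (hb z)
  zero_mem' := fun z => by rw [map_zero]; exact Commute.zero_left z
  smul_mem' := fun c a ha z => by rw [map_smul]; exact (ha z).smul_left c

theorem mem_centralComul_of_commute {h : H} (hl : ∀ y, Commute (comul (R := k) h) (y ⊗ₜ 1))
    (hr : ∀ y, Commute (comul (R := k) h) (1 ⊗ₜ y)) : h ∈ centralComul k H := by
  intro z
  induction z with
  | zero => exact Commute.zero_right _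
  | add a b ha hb => exact ha.add_right hb
  | tmul a b =>
    have : a ⊗ₜ[k] b = (a ⊗ₜ 1) * (1 ⊗ₜ b) := by simp
    rw [this]
    exact (hl a).mul_right (hr b)

/-- Centrality of h need not be assumed: applying ε ⊗ id to the hypothesis yields it. -/
theorem mem_centralComul_of_right {h : H} (hr : ∀ y, Commute (comul (R := k) h) (1 ⊗ₜ y)) :
    h ∈ centralComul k H :=
  mem_centralComul_of_commute (commute_comul_left (central_of_commute_comul_right (k := k) hr) hr) hr

theorem mem_centralComul_of_left {h : H} (hh : ∀ x, Commute h x)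
    (hl : ∀ y, Commute (comul (R := k) h) (y ⊗ₜ 1)) :
    h ∈ centralComul k H :=
  mem_centralComul_of_commute hl (commute_comul_right hh hl)

theorem commute_of_mem_centralComul {h : H} (hh : h ∈ centralComul k H) (x : H) : Commute h x :=
  central_of_commute_comul_right (k := k) (fun y => hh (1 ⊗ₜ y)) x

theorem le_centralComul_of_isLeftCoideal {N : Submodule k H} (hN : IsLeftCoideal N)
    (hc : N ≤ Subalgebra.toSubmodule (Subalgebra.center k H)) : N ≤ centralComul k H := by
  intro h hh
  refine mem_centralComul_of_right fun y => ?_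
  refine tensorSub_induction (p := fun t => Commute t (1 ⊗ₜ y)) (hN h hh) ?_
    fun _ _ => Commute.add_left
  intro m _ n hn
  have : n * y = y * n := ((Subalgebra.mem_center_iff (R := k)).1 (hc hn) y).symm
  simp [Commute, SemiconjBy, this]

theorem le_centralComul_of_isRightCoideal {N : Submodule k H} (hN : IsRightCoideal N)
    (hc : N ≤ Subalgebra.toSubmodule (Subalgebra.center k H)) : N ≤ centralComul k H := by
  intro h hh
  refine mem_centralComul_of_left (fun x => ((Subalgebra.mem_center_iff (R := k)).1 (hc hh) x).symm)
    fun y => ?_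
  refine tensorSub_induction (p := fun t => Commute t (y ⊗ₜ 1)) (hN h hh) ?_
    fun _ _ => Commute.add_left
  intro m hm n _
  have : m * y = y * m := ((Subalgebra.mem_center_iff (R := k)).1 (hc hm) y).symm
  simp [Commute, SemiconjBy, this]

/-- Coassociativity: both sides are ∑ f(h₁) h₂ ⊗ h₃. -/
theorem comul_sliceLeft (f : Module.Dual k H) (h : H) :
    comul (R := k) (sliceLeft f (comul h)) =
      (sliceLeft f ∘ₗ comul).rTensor H (comul (R := k) h) := by
  have h1 : ∀ (w : H ⊗[k] H) (c : H),
      TensorProduct.lid k _ (f.rTensor _ (TensorProduct.assoc k H H H (w ⊗ₜ c)))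
      = sliceLeft f w ⊗ₜ c := by
    intro w c
    induction w with
    | zero => simp
    | add a b ha hb => simp only [TensorProduct.add_tmul, map_add, ha, hb]
    | tmul a b => simp [TensorProduct.smul_tmul']
  have h2 := congrArg (fun t => TensorProduct.lid k _ (f.rTensor _ t)) (coassoc_apply (R := k) h)
  rw [← (ℛ k h).eq] at h2 ⊢
  simp only [map_sum, LinearMap.rTensor_tmul, h1, LinearMap.lTensor_tmul,
    TensorProduct.lid_tmul] at h2
  simp [h2]

theorem comul_sliceRight (f : Module.Dual k H) (h : H) :
    comul (R := k) (sliceRight f (comul h)) =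
      (sliceRight f ∘ₗ comul).lTensor H (comul (R := k) h) := by
  have h1 : ∀ (w : H ⊗[k] H) (c : H),
      TensorProduct.rid k _ (f.lTensor _ ((TensorProduct.assoc k H H H).symm (c ⊗ₜ w)))
      = c ⊗ₜ sliceRight f w := by
    intro w c
    induction w with
    | zero => simp
    | add a b ha hb => simp only [TensorProduct.tmul_add, map_add, ha, hb]
    | tmul a b => simp
  have h2 := congrArg (fun t => TensorProduct.rid k _ (f.lTensor _ t))
    (coassoc_symm_apply (R := k) h)
  rw [← (ℛ k h).eq] at h2 ⊢
  simp only [map_sum, LinearMap.lTensor_tmul, h1, LinearMap.rTensor_tmul,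
    TensorProduct.rid_tmul] at h2
  simp [h2]

theorem commute_rTensor {t : H ⊗[k] H} {y : H} (g : H →ₗ[k] H) (ht : Commute t (1 ⊗ₜ y)) :
    Commute (g.rTensor H t) (1 ⊗ₜ y) := by
  have e1 : ∀ t : H ⊗[k] H, g.rTensor H (t * (1 ⊗ₜ y)) = g.rTensor H t * (1 ⊗ₜ y) := by
    intro t
    induction t with
    | zero => simp
    | add a b ha hb => simp only [add_mul, map_add, ha, hb]
    | tmul a b => simp
  have e2 : ∀ t : H ⊗[k] H, g.rTensor H ((1 ⊗ₜ y) * t) = (1 ⊗ₜ y) * g.rTensor H t := by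
    intro t
    induction t with
    | zero => simp
    | add a b ha hb => simp only [mul_add, map_add, ha, hb]
    | tmul a b => simp
  have := congrArg (g.rTensor H) ht.eq
  rwa [e1, e2] at this

theorem commute_lTensor {t : H ⊗[k] H} {y : H} (g : H →ₗ[k] H) (ht : Commute t (y ⊗ₜ 1)) :
    Commute (g.lTensor H t) (y ⊗ₜ 1) := by
  have e1 : ∀ t : H ⊗[k] H, g.lTensor H (t * (y ⊗ₜ 1)) = g.lTensor H t * (y ⊗ₜ 1) := by
    intro t
    induction t with
    | zero => simp
    | add a b ha hb => simp only [add_mul, map_add, ha, hb]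
    | tmul a b => simp
  have e2 : ∀ t : H ⊗[k] H, g.lTensor H ((y ⊗ₜ 1) * t) = (y ⊗ₜ 1) * g.lTensor H t := by
    intro t
    induction t with
    | zero => simp
    | add a b ha hb => simp only [mul_add, map_add, ha, hb]
    | tmul a b => simp
  have := congrArg (g.lTensor H) ht.eq
  rwa [e1, e2] at this

/-- The comultiplication of the slice arises from Δ(h) by a linear map on the first leg, so it still
commutes with every 1 ⊗ y. -/
theorem sliceLeft_comul_mem_centralComul {h : H} (hh : h ∈ centralComul k H)
    (f : Module.Dual k H) : sliceLeft f (comul h) ∈ centralComul k H := by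
  refine mem_centralComul_of_right fun y => ?_
  rw [comul_sliceLeft]
  exact commute_rTensor _ (hh _)

theorem sliceRight_comul_mem_centralComul {h : H} (hh : h ∈ centralComul k H)
    (f : Module.Dual k H) : sliceRight f (comul h) ∈ centralComul k H := by
  refine mem_centralComul_of_left (fun x => ?_) fun y => ?_
  -- Slicing the second leg is linear over multiplication by x ⊗ 1 on either side, so the slice is
  -- central.
  · have e1 : ∀ t : H ⊗[k] H, sliceRight f (t * (x ⊗ₜ 1)) = sliceRight f t * x := by
      intro t
      induction t with
      | zero => simp
      | add a b ha hb => simp only [add_mul, map_add, ha, hb]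
      | tmul a b => simp
    have e2 : ∀ t : H ⊗[k] H, sliceRight f ((x ⊗ₜ 1) * t) = x * sliceRight f t := by
      intro t
      induction t with
      | zero => simp
      | add a b ha hb => simp only [mul_add, map_add, ha, hb]
      | tmul a b => simp
    have := congrArg (sliceRight f) (hh (x ⊗ₜ 1)).eq
    rwa [e1, e2] at this
  · rw [comul_sliceRight]
    exact commute_lTensor _ (hh _)

theorem comul_mem_tensorSub_centralComul {h : H} (hh : h ∈ centralComul k H) :
    comul (R := k) h ∈ tensorSub (centralComul k H) (centralComul k H) :=
  mem_tensorSub (sliceRight_comul_mem_centralComul hh) (sliceLeft_comul_mem_centralComul hh)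

theorem one_mem_centralComul : (1 : H) ∈ centralComul k H := fun z => by
  rw [Bialgebra.comul_one]; exact Commute.one_left z

theorem mul_mem_centralComul {x y : H} (hx : x ∈ centralComul k H) (hy : y ∈ centralComul k H) :
    x * y ∈ centralComul k H := fun z => by
  rw [Bialgebra.comul_mul]; exact (hx z).mul_left (hy z)

variable (k H) in
theorem isHopfSubalgebra_centralComul [Module.Finite k H] :
    IsHopfSubalgebra (centralComul k H) where
  one_mem := one_mem_centralComul
  mul_mem := mul_mem_centralComul
  comul_mem := comul_mem_tensorSub_centralComul
  antipode_mem := antipode_mem_of_subbialgebra (fun _ => comul_mem_tensorSub_centralComul)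
    one_mem_centralComul fun _ hx _ hy => mul_mem_centralComul hx hy

variable (k H) in
theorem centralComul_le_center :
    centralComul k H ≤ Subalgebra.toSubmodule (Subalgebra.center k H) := fun _ hh =>
  (Subalgebra.mem_center_iff (R := k)).2 fun x => (commute_of_mem_centralComul (k := k) hh x).symm

end CentralComul

/-! ### The adjoint action along an algebra map. -/

section AdjointAction

variable {k : Type u} {H : Type v} [Field k] [Ring H] [HopfAlgebra k H]
variable {B : Type*} [Ring B] [Algebra k B] {B' : Type*} [Ring B'] [Algebra k B']

/-- The bilinear map `a ⊗ c ↦ (b ↦ ρ a * b * ρ (S c))` on tensors. -/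
def conjTensor (ρ : H →ₐ[k] B) : H ⊗[k] H →ₗ[k] Module.End k B :=
  TensorProduct.lift (LinearMap.mk₂ k
    (fun a c => LinearMap.mulLeft k (ρ a) ∘ₗ LinearMap.mulRight k (ρ (antipode k c)))
    (by intros; ext; simp [add_mul]) (by intros; ext; simp)
    (by intros; ext; simp [mul_add]) (by intros; ext; simp))

@[simp] theorem conjTensor_tmul (ρ : H →ₐ[k] B) (a c : H) (b : B) :
    conjTensor ρ (a ⊗ₜ c) b = ρ a * b * ρ (antipode k c) := by
  simp [conjTensor, mul_assoc]

/-- The adjoint action `h ↦ (b ↦ ∑ ρ h₁ * b * ρ (S h₂))` of `H` on an algebra `B`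
along `ρ : H → B`. -/
def adjointAction (ρ : H →ₐ[k] B) : H →ₗ[k] Module.End k B := conjTensor ρ ∘ₗ comul

theorem adjointAction_apply (ρ : H →ₐ[k] B) {ι : Type*} {h : H} (r : Coalgebra.Repr k h ι) (b : B) :
    adjointAction ρ h b = ∑ i ∈ r.index, ρ (r.left i) * b * ρ (antipode k (r.right i)) := by
  simp [adjointAction, ← r.eq]

theorem adjointAction_one (ρ : H →ₐ[k] B) : adjointAction ρ 1 = 1 := by
  ext b
  simp [adjointAction, Algebra.TensorProduct.one_def]

theorem adjointAction_mul (ρ : H →ₐ[k] B) (x y : H) :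
    adjointAction ρ (x * y) = adjointAction ρ x * adjointAction ρ y := by
  ext b
  rw [adjointAction_apply ρ ((ℛ k x).mul (ℛ k y)), Module.End.mul_apply,
    adjointAction_apply ρ (ℛ k x), adjointAction_apply ρ (ℛ k y)]
  simp [Finset.sum_product, Finset.mul_sum, Finset.sum_mul, antipode_mul_antidistrib, mul_assoc]

/-- Naturality is what lets the adjoint action on H be tested on End V for simple V. -/
theorem map_adjointAction (ρ : H →ₐ[k] B) (φ : B →ₐ[k] B') (h : H) (b : B) :
    φ (adjointAction ρ h b) = adjointAction (φ.comp ρ) h (φ b) := by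
  simp [adjointAction_apply _ (ℛ k h)]

end AdjointAction

/-! ### Traces on endomorphism algebras and of idempotents. -/

section Trace

variable {k : Type*} {V : Type*} [Field k] [AddCommGroup V] [Module k V] [Module.Finite k V]

/-- On matrix units, the diagonal coefficient of X ↦ fXg at E_ij is f_ii g_jj. -/
theorem trace_mulLeft_comp_mulRight (f g : Module.End k V) :
    LinearMap.trace k (Module.End k V) (LinearMap.mulLeft k f ∘ₗ LinearMap.mulRight k g)
      = LinearMap.trace k V f * LinearMap.trace k V g := by
  classical
  let b := Module.finBasis k V
  rw [LinearMap.trace_eq_matrix_trace k (b.linearMap b), LinearMap.trace_eq_matrix_trace k b f,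
    LinearMap.trace_eq_matrix_trace k b g, Matrix.trace, Matrix.trace, Matrix.trace,
    Fintype.sum_prod_type, Finset.sum_mul_sum]
  refine Finset.sum_congr rfl fun i _ => Finset.sum_congr rfl fun j _ => ?_
  have h : (LinearMap.mulLeft k f ∘ₗ LinearMap.mulRight k g) (b.linearMap b (i, j))
      = f * (Matrix.toLin b b (Matrix.single i j 1) * g) := by
    rw [Module.Basis.linearMap_apply, Matrix.stdBasis_eq_single]; rfl
  rw [Matrix.diag_apply, LinearMap.toMatrix_apply, h, Module.Basis.linearMap_repr_apply,
    LinearMap.toMatrix_mul, LinearMap.toMatrix_mul, LinearMap.toMatrix_toLin]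
  change (LinearMap.toMatrix b b f * (Matrix.single i j 1 * LinearMap.toMatrix b b g) :
    Matrix _ _ k) i j = _
  simp [Matrix.mul_apply, Matrix.single_apply, ite_and]

theorem exists_natCast_eq_trace_of_isIdempotentElem {e : Module.End k V}
    (he : IsIdempotentElem e) : ∃ n : ℕ, LinearMap.trace k V e = n ∧ (n = 0 → e = 0) := by
  refine ⟨Module.finrank k (LinearMap.range e),
    LinearMap.IsProj.trace (LinearMap.IsIdempotentElem.isProj_range e he), fun h => ?_⟩
  exact LinearMap.range_eq_bot.1 (Submodule.finrank_eq_zero.1 h)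

end Trace

/-! ### χ_ad and the matrix coefficients of the adjoint representation. -/

section Characters

variable {k : Type u} {H : Type v} [Field k] [Ring H] [HopfAlgebra k H]

/-- Such a y kills the class of 1 in every H/m, so it lies in the Jacobson radical, which is zero.
-/
theorem eq_zero_of_forall_isSimpleModule [IsSemisimpleRing H] {y : H}
    (h : ∀ (V : Type v) [AddCommGroup V] [Module k V] [Module H V] [IsScalarTower k H V]
      [IsSimpleModule H V], Algebra.lsmul k k V y = (0 : Module.End k V)) : y = 0 := by
  have hy : y ∈ Ring.jacobson H := by
    rw [Ring.jacobson_eq_sInf_isMaximal, Submodule.mem_sInf]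
    intro m hm
    have hm' : Ideal.IsMaximal m := hm
    have : IsSimpleModule H (H ⧸ m) := isSimpleModule_iff_isCoatom.2 hm'.out
    have h1 := LinearMap.congr_fun (h (H ⧸ m)) (Submodule.Quotient.mk 1)
    have h2 : y • (Submodule.Quotient.mk 1 : H ⧸ m) = 0 := h1
    rw [← Submodule.Quotient.mk_smul, Submodule.Quotient.mk_eq_zero] at h2
    simpa using h2
  rw [IsSemisimpleRing.jacobson_eq_bot] at hy
  exact (Submodule.mem_bot H).1 hy

/-- The matrix coefficient `h ↦ f (ad h y)` of the adjoint representation. -/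
def adjointCoeff (f : Module.Dual k H) (y : H) : HDual k H :=
  (toDual k H).symm (f ∘ₗ LinearMap.applyₗ y ∘ₗ adjointAction (AlgHom.id k H))

@[simp] theorem adjointCoeff_apply (f : Module.Dual k H) (y h : H) :
    adjointCoeff f y h = f (adjointAction (AlgHom.id k H) h y) := rfl

variable [Module.Finite k H]

theorem mem_of_forall_apply_eq_zero {C : Submodule k (HDual k H)} {p : HDual k H}
    (h : ∀ x : H, (∀ q ∈ C, q x = 0) → p x = 0) : p ∈ C := by
  let W : Submodule k (Module.Dual k H) := C.map (toDual k H).toLinearMap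
  have hp : toDual k H p ∈ W := by
    rw [← Subspace.dualCoannihilator_dualAnnihilator_eq (W := W), Submodule.mem_dualAnnihilator]
    intro x hx
    rw [Submodule.mem_dualCoannihilator] at hx
    exact h x fun q hq => hx _ (Submodule.mem_map_of_mem hq)
  obtain ⟨q, hq, hqp⟩ := hp
  rwa [← (toDual k H).injective hqp]

theorem antipode_dual_apply (p : HDual k H) (a : H) : antipode k p a = p (antipode k a) := rfl

theorem character_mul_antipode_apply (V : Type v) [AddCommGroup V] [Module k V] [Module H V]
    [IsScalarTower k H V] [Module.Finite k V] (h : H) :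
    (character k H V * antipode k (character k H V)) h =
      LinearMap.trace k (Module.End k V)
        (adjointAction (Algebra.lsmul k k V : H →ₐ[k] Module.End k V) h) := by
  rw [mul_apply (ℛ k h), adjointAction, LinearMap.comp_apply]
  conv_rhs => rw [← (ℛ k h).eq]
  rw [map_sum, map_sum]
  refine Finset.sum_congr rfl fun i _ => ?_
  exact (trace_mulLeft_comp_mulRight _ _).symm

variable (k) in
theorem finite_of_isSimpleModule (V : Type*) [AddCommGroup V] [Module k V] [Module H V]
    [IsScalarTower k H V] [IsSimpleModule H V] : Module.Finite k V :=
  Module.Finite.trans H V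

theorem chiAd_apply [IsSemisimpleRing H] (h : H) :
    chiAd k H h = ∑ χ ∈ (Irr_finite k H).toFinset, (χ * antipode k χ) h := by
  rw [chiAd, finsum_mem_eq_finite_toFinset_sum _ (Irr_finite k H)]
  exact map_sum (LinearMap.applyₗ h ∘ₗ (toDual k H).toLinearMap) _ _

variable [CharZero k] [IsSemisimpleRing H]

/-- Each term of χ_ad(e) is the trace of an idempotent on some End V, hence a natural number. In
characteristic 0 no cancellation is possible, so e acts as zero on every End V, and these jointly
detect H. -/
theorem adjointAction_eq_zero_of_chiAd_eq_zero {e : H} (he : IsIdempotentElem e)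
    (h : chiAd k H e = 0) : adjointAction (AlgHom.id k H) e = 0 := by
  have hidem : ∀ {B : Type v} [Ring B] [Algebra k B] (ρ : H →ₐ[k] B),
      IsIdempotentElem (adjointAction ρ e) := fun ρ => by
    rw [IsIdempotentElem, ← adjointAction_mul, he.eq]
  have hnat : ∀ χ ∈ (Irr_finite k H).toFinset, ∃ n : ℕ, (χ * antipode k χ) e = n := by
    intro χ hχ
    obtain ⟨V, _, _, _, _, hV, rfl⟩ := (Irr_finite k H).mem_toFinset.1 hχ
    have := finite_of_isSimpleModule k (H := H) V
    obtain ⟨n, hn, -⟩ := exists_natCast_eq_trace_of_isIdempotentElem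
      (hidem (Algebra.lsmul k k V : H →ₐ[k] Module.End k V))
    exact ⟨n, by rw [character_mul_antipode_apply, hn]⟩
  choose! n hn using hnat
  rw [chiAd_apply, Finset.sum_congr rfl hn, ← Nat.cast_sum, Nat.cast_eq_zero,
    Finset.sum_eq_zero_iff] at h
  ext y
  refine eq_zero_of_forall_isSimpleModule (k := k) fun V _ _ _ _ _ => ?_
  have := finite_of_isSimpleModule k (H := H) V
  have hχ : character k H V ∈ (Irr_finite k H).toFinset :=
    (Irr_finite k H).mem_toFinset.2 ⟨V, _, _, _, _, ‹_›, rfl⟩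
  obtain ⟨m, hm, hm0⟩ := exists_natCast_eq_trace_of_isIdempotentElem
    (hidem (Algebra.lsmul k k V : H →ₐ[k] Module.End k V))
  have h0 := hn _ hχ
  rw [h _ hχ, character_mul_antipode_apply, hm, Nat.cast_inj] at h0
  rw [map_adjointAction, AlgHom.comp_id, hm0 h0, LinearMap.zero_apply]

theorem adjointCoeff_mem {C : Submodule k (HDual k H)}
    (hC : ∀ p ∈ C, comul (R := k) p ∈ tensorSub C C) (hχ : chiAd k H ∈ C)
    (f : Module.Dual k H) (y : H) : adjointCoeff f y ∈ C := by
  -- The annihilator of C; it is a left ideal because the second leg of Δ(q) stays in C.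
  let I : Ideal H :=
    { carrier := {x | ∀ q ∈ C, q x = 0}
      add_mem' := fun ha hb q hq => by rw [map_add, ha q hq, hb q hq, add_zero]
      zero_mem' := fun q _ => map_zero q
      smul_mem' := fun a x hx q hq => by
        rw [smul_eq_mul, ← dualTensorEquiv_comul]
        refine tensorSub_induction (p := fun t => dualTensorEquiv k H t (a ⊗ₜ x) = 0)
          (hC q hq) ?_ ?_
        · intro m _ n hn
          rw [dualTensorEquiv_tmul, hx n hn, mul_zero]
        · intro s t hs ht
          rw [map_add, LinearMap.add_apply, hs, ht, add_zero] }
  obtain ⟨e, he, hI⟩ := IsSemisimpleRing.ideal_eq_span_idempotent I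
  have heI : e ∈ I := hI ▸ Ideal.mem_span_singleton_self e
  have h0 := adjointAction_eq_zero_of_chiAd_eq_zero he (heI _ hχ)
  -- By double annihilators it suffices that the coefficient vanishes on I = He.
  refine mem_of_forall_apply_eq_zero fun x hx => ?_
  have hxI : x ∈ Ideal.span {e} := hI ▸ (show x ∈ I from hx)
  obtain ⟨a, rfl⟩ := Ideal.mem_span_singleton'.1 hxI
  rw [adjointCoeff_apply, adjointAction_mul, h0, mul_zero, LinearMap.zero_apply, map_zero]

end Characters

/-! ### Comparison of the invariants with the central-comultiplication subalgebra. -/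

section Invariants

variable {k : Type u} {H : Type v} [Field k] [Ring H] [HopfAlgebra k H]

theorem leftHit_eq_sliceRight (p : HDual k H) (h : H) :
    leftHit p h = sliceRight (toDual k H p) (comul h) := rfl

/-- In the convolution algebra, h ↦ ad(h)y is id * (y·S), and S cancels id. -/
theorem sum_antipode_mul_adjointAction (h y : H) :
    ∑ i ∈ (ℛ k h).index, antipode k ((ℛ k h).left i) *
      adjointAction (AlgHom.id k H) ((ℛ k h).right i) y = y * antipode k h := by
  let s : WithConv (H →ₗ[k] H) := WithConv.toConv (antipode k (A := H))
  let ys : WithConv (H →ₗ[k] H) := WithConv.toConv (LinearMap.mulLeft k y ∘ₗ antipode k (A := H))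
  let ad : WithConv (H →ₗ[k] H) :=
    WithConv.toConv (LinearMap.applyₗ y ∘ₗ adjointAction (AlgHom.id k H))
  have h1 : ad = WithConv.toConv LinearMap.id * ys := by
    ext x
    rw [(ℛ k x).convMul_apply]
    refine (adjointAction_apply (AlgHom.id k H) (ℛ k x) y).trans ?_
    exact Finset.sum_congr rfl fun i _ => mul_assoc _ _ _
  have h2 : s * ad = ys := by
    rw [h1, ← mul_assoc, LinearMap.antipode_mul_id, one_mul]
  have h3 := congrArg (fun f : WithConv (H →ₗ[k] H) => f h) h2
  simp only [(ℛ k h).convMul_apply] at h3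
  exact h3

/-- If `∑ h₁ ⊗ ad h₂ y = h ⊗ y`, then `S h` commutes with `y`. -/
theorem antipode_mul_comm_of_adjointAction {h y : H}
    (hy : (LinearMap.applyₗ y ∘ₗ adjointAction (AlgHom.id k H)).lTensor H (comul (R := k) h)
      = h ⊗ₜ y) : antipode k h * y = y * antipode k h := by
  rw [← sum_antipode_mul_adjointAction]
  have := congrArg (LinearMap.mul' k H ∘ₗ (antipode k (A := H)).rTensor H) hy
  rw [← (ℛ k h).eq] at this
  simpa using this.symm

/-- The invariants of any subspace of `H^*` form a left coideal. -/
theorem sliceLeft_comul_mem_hitInvariants {T : Submodule k (HDual k H)} {h : H}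
    (hh : h ∈ hitInvariants T) (f : Module.Dual k H) :
    sliceLeft f (comul h) ∈ hitInvariants T := by
  intro p hp
  have h1 := hh p hp
  rw [leftHit_eq_sliceRight] at h1 ⊢
  rw [comul_sliceLeft, sliceRight_map, h1]
  simp

variable (k H) in
/-- The functionals on `H` vanishing on `H K⁺`, where `K` is the set of elements whose
comultiplication is central. -/
def centralComulQuotientDual : Submodule k (HDual k H) where
  carrier := {p | ∀ l ∈ centralComul k H, ∀ x, p (l * x) = counit (R := k) l * p x}
  add_mem' := fun ha hb l hl x => by rw [add_apply, add_apply, ha l hl, hb l hl, mul_add]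
  zero_mem' := fun l _ x => by simp
  smul_mem' := fun c a ha l hl x => by rw [smul_apply, smul_apply, ha l hl, mul_left_comm]

theorem one_mem_centralComulQuotientDual : 1 ∈ centralComulQuotientDual k H := fun l _ x => by
  simp

variable [Module.Finite k H]

theorem commute_of_antipode_commute {h : H} (hS : ∀ y, antipode k h * y = y * antipode k h)
    (x : H) : Commute h x := by
  apply antipode_injective k H
  rw [antipode_mul_antidistrib, antipode_mul_antidistrib, hS]

theorem central_smul_eq [IsAlgClosed k] (V : Type*) [AddCommGroup V] [Module k V] [Module H V]
    [IsScalarTower k H V] [IsSimpleModule H V] {z : H} (hz : ∀ x, Commute z x) :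
    ∃ c : k, ∀ v : V, z • v = c • v := by
  have := finite_of_isSimpleModule k (H := H) V
  let g : Module.End H V :=
    { toFun := fun v => z • v
      map_add' := smul_add z
      map_smul' := fun x v => by
        rw [RingHom.id_apply, ← mul_smul, ← mul_smul, (hz x).eq] }
  obtain ⟨c, hc⟩ := (IsSimpleModule.algebraMap_end_bijective_of_isAlgClosed k
    (A := H) (V := V)).2 g
  exact ⟨c, fun v => (LinearMap.congr_fun hc v).symm⟩

/-- The first leg of Δ(l) is central, hence scalar on V by Schur, so it moves past g and meets
S(l₂): ρ(l₁) g ρ(S l₂) sums to g ρ(l₁ S l₂) = ε(l) g. -/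
theorem adjointAction_end_eq_counit_smul [IsAlgClosed k] (V : Type*) [AddCommGroup V]
    [Module k V] [Module H V]
    [IsScalarTower k H V] [IsSimpleModule H V] {l : H} (hl : l ∈ centralComul k H) :
    adjointAction (Algebra.lsmul k k V : H →ₐ[k] Module.End k V) l
      = counit (R := k) l • (1 : Module.End k (Module.End k V)) := by
  refine LinearMap.ext fun g => ?_
  let ρ : H →ₐ[k] Module.End k V := Algebra.lsmul k k V
  have key : conjTensor ρ (comul l) g =
      g * ρ (LinearMap.mul' k H ((antipode k (A := H)).lTensor H (comul l))) := by
    refine tensorSub_induction (p := fun t => conjTensor ρ t g =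
      g * ρ (LinearMap.mul' k H ((antipode k (A := H)).lTensor H t)))
      (comul_mem_tensorSub_centralComul hl) ?_ ?_
    · intro m hm n _
      obtain ⟨c, hc⟩ := central_smul_eq (k := k) V (commute_of_mem_centralComul hm)
      ext v
      simp [ρ, hc]
    · intro s t hs ht
      simp only [map_add, LinearMap.add_apply, hs, ht, mul_add]
  rw [mul_antipode_lTensor_comul_apply] at key
  refine key.trans ?_
  ext v
  simp

theorem sliceLeft_comul_dual_apply (a : H) (p : HDual k H) (x : H) :
    sliceLeft (LinearMap.applyₗ a ∘ₗ (toDual k H).toLinearMap) (comul (R := k) p) x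
      = p (a * x) := by
  rw [← dualTensorEquiv_comul]
  induction comul (R := k) p with
  | zero => simp
  | add s t hs ht => simp only [map_add, add_apply, LinearMap.add_apply, hs, ht]
  | tmul s t => simp

theorem sliceRight_comul_dual_apply (a : H) (p : HDual k H) (x : H) :
    sliceRight (LinearMap.applyₗ a ∘ₗ (toDual k H).toLinearMap) (comul (R := k) p) x
      = p (x * a) := by
  rw [← dualTensorEquiv_comul]
  induction comul (R := k) p with
  | zero => simp
  | add s t hs ht => simp only [map_add, add_apply, LinearMap.add_apply, hs, ht]
  | tmul s t => simp [mul_comm]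

theorem exists_eq_apply (f : Module.Dual k (HDual k H)) :
    ∃ a : H, f = LinearMap.applyₗ a ∘ₗ (toDual k H).toLinearMap := by
  refine ⟨(Module.evalEquiv k H).symm (f ∘ₗ (toDual k H).symm.toLinearMap), ?_⟩
  ext p
  simp

theorem comul_mem_centralComulQuotientDual {p : HDual k H}
    (hp : p ∈ centralComulQuotientDual k H) :
    comul (R := k) p ∈
      tensorSub (centralComulQuotientDual k H) (centralComulQuotientDual k H) := by
  refine mem_tensorSub (fun f => ?_) fun f => ?_
  · obtain ⟨a, rfl⟩ := exists_eq_apply f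
    intro l hl x
    rw [sliceRight_comul_dual_apply, sliceRight_comul_dual_apply, mul_assoc, hp l hl]
  · obtain ⟨a, rfl⟩ := exists_eq_apply f
    intro l hl x
    -- The defining condition needs l in front, so centrality moves it past a.
    rw [sliceLeft_comul_dual_apply, sliceLeft_comul_dual_apply, ← mul_assoc,
      ← (commute_of_mem_centralComul hl a).eq, mul_assoc, hp l hl]

theorem mul_mem_centralComulQuotientDual {p q : HDual k H}
    (hp : p ∈ centralComulQuotientDual k H) (hq : q ∈ centralComulQuotientDual k H) :
    p * q ∈ centralComulQuotientDual k H := by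
  intro l hl x
  have h1 : ∀ (w : H), (p * q) w = dualTensorEquiv k H (p ⊗ₜ q) (comul w) := by
    intro w
    rw [mul_apply (ℛ k w)]
    conv_rhs => rw [← (ℛ k w).eq]
    simp
  have h2 : ∀ t : H ⊗[k] H, ∀ m ∈ centralComul k H, ∀ n ∈ centralComul k H,
      dualTensorEquiv k H (p ⊗ₜ q) ((m ⊗ₜ n) * t)
        = (counit (R := k) m * counit (R := k) n) * dualTensorEquiv k H (p ⊗ₜ q) t := by
    intro t m hm n hn
    induction t with
    | zero => simp
    | add s t hs ht => rw [mul_add, map_add, map_add, mul_add, hs, ht]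
    | tmul s t =>
      rw [Algebra.TensorProduct.tmul_mul_tmul, dualTensorEquiv_tmul, dualTensorEquiv_tmul,
        hp m hm, hq n hn]
      ring
  -- Writing ε(l) as ε((ε ⊗ id)Δ(l)) makes both sides linear in Δ(l), which lies in K ⊗ K.
  have h3 : dualTensorEquiv k H (p ⊗ₜ q) (comul l * comul x)
      = counit (R := k) (sliceLeft (counit (R := k)) (comul (R := k) l))
        * dualTensorEquiv k H (p ⊗ₜ q) (comul x) := by
    refine tensorSub_induction (p := fun t => dualTensorEquiv k H (p ⊗ₜ q) (t * comul x)
      = counit (R := k) (sliceLeft (counit (R := k)) t)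
        * dualTensorEquiv k H (p ⊗ₜ q) (comul x)) (comul_mem_tensorSub_centralComul hl) ?_ ?_
    · intro m hm n hn
      rw [h2 _ m hm n hn]
      simp
    · intro s t hs ht
      simp only [add_mul, map_add, hs, ht]
  rw [h1, h1, Bialgebra.comul_mul, h3]
  simp [sliceLeft]

variable (k H) in
theorem isHopfSubalgebra_centralComulQuotientDual :
    IsHopfSubalgebra (centralComulQuotientDual k H) where
  one_mem := one_mem_centralComulQuotientDual
  mul_mem := mul_mem_centralComulQuotientDual
  comul_mem := comul_mem_centralComulQuotientDual
  antipode_mem := fun {p} hp l hl x => by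
    rw [antipode_dual_apply, antipode_dual_apply, antipode_mul_antidistrib,
      ← (commute_of_mem_centralComul
        ((isHopfSubalgebra_centralComul k H).antipode_mem hl) _).eq,
      hp _ ((isHopfSubalgebra_centralComul k H).antipode_mem hl), counit_antipode]

variable (k H) in
-- Each summand is the trace of the action on End V, where l acts as ε(l).
theorem chiAd_mem_centralComulQuotientDual [IsAlgClosed k] [IsSemisimpleRing H] :
    chiAd k H ∈ centralComulQuotientDual k H := by
  intro l hl x
  rw [chiAd_apply, chiAd_apply, Finset.mul_sum]
  refine Finset.sum_congr rfl fun χ hχ => ?_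
  obtain ⟨V, _, _, _, _, hV, rfl⟩ := (Irr_finite k H).mem_toFinset.1 hχ
  have := finite_of_isSimpleModule k (H := H) V
  rw [character_mul_antipode_apply, character_mul_antipode_apply, adjointAction_mul,
    adjointAction_end_eq_counit_smul V hl, smul_mul_assoc, one_mul, map_smul, smul_eq_mul]

variable (k H) [IsSemisimpleRing H]

theorem centralComul_le_tildeZ [IsAlgClosed k] : centralComul k H ≤ tildeZ k H := by
  intro h hh p hp
  have hp' : p ∈ centralComulQuotientDual k H :=
    (Submodule.mem_sInf.1 hp) _ ⟨isHopfSubalgebra_centralComulQuotientDual k H,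
      Set.singleton_subset_iff.2 (chiAd_mem_centralComulQuotientDual k H)⟩
  -- On K, p agrees with p(1)ε; here h is replaced by (id ⊗ ε)Δ(h) so that the claim can be checked
  -- on pure tensors.
  have key : leftHit p h = p 1 • sliceRight (counit (R := k)) (comul (R := k) h) := by
    rw [leftHit_eq_sliceRight]
    refine tensorSub_induction (p := fun t => sliceRight (toDual k H p) t
      = p 1 • sliceRight (counit (R := k)) t) (comul_mem_tensorSub_centralComul hh) ?_ ?_
    · intro m _ n hn
      have := hp' n hn 1
      rw [mul_one] at this
      rw [sliceRight_tmul, sliceRight_tmul, toDual_apply, this, mul_comm, mul_smul]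
    · intro s t hs ht
      simp only [map_add, smul_add, hs, ht]
  rw [key]
  simp [sliceRight]

theorem commute_of_mem_tildeZ [CharZero k] {h : H} (hh : h ∈ tildeZ k H) (x : H) :
    Commute h x := by
  refine commute_of_antipode_commute (k := k) (fun y => antipode_mul_comm_of_adjointAction ?_) x
  -- Slicing by f turns the tensor identity into invariance of h under the coefficient `adjointCoeff
  -- f y`, whose value at 1 is f(y).
  refine ext_sliceRight fun f => ?_
  have hmem : adjointCoeff f y ∈ dualAd k H := Submodule.mem_sInf.2 fun C hC =>
    adjointCoeff_mem (fun _ => hC.1.comul_mem) (Set.singleton_subset_iff.1 hC.2) f y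
  have h1 := hh _ hmem
  rw [adjointCoeff_apply, adjointAction_one, Module.End.one_apply, leftHit_eq_sliceRight] at h1
  rw [sliceRight_tmul, ← h1]
  simp only [sliceRight, LinearMap.comp_apply, LinearEquiv.coe_coe]
  rw [← LinearMap.comp_apply, ← LinearMap.lTensor_comp]
  rfl

theorem tildeZ_eq_centralComul [IsAlgClosed k] [CharZero k] : tildeZ k H = centralComul k H := by
  refine le_antisymm (fun h hh => mem_centralComul_of_right fun y => ?_)
    (centralComul_le_tildeZ k H)
  have e1 : ∀ (f : Module.Dual k H) (t : H ⊗[k] H),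
      sliceLeft f (t * (1 ⊗ₜ y)) = sliceLeft f t * y := by
    intro f t
    induction t with
    | zero => simp
    | add a b ha hb => simp only [add_mul, map_add, ha, hb]
    | tmul a b => simp
  have e2 : ∀ (f : Module.Dual k H) (t : H ⊗[k] H),
      sliceLeft f ((1 ⊗ₜ y) * t) = y * sliceLeft f t := by
    intro f t
    induction t with
    | zero => simp
    | add a b ha hb => simp only [mul_add, map_add, ha, hb]
    | tmul a b => simp
  -- Left slices of Δ(h) stay in Z̃(H), hence are central, so Δ(h) commutes with 1 ⊗ y.
  refine ext_sliceLeft fun f => ?_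
  rw [e1, e2]
  exact (commute_of_mem_tildeZ k H (sliceLeft_comul_mem_hitInvariants hh f) y).eq

end Invariants
end HopfCenter
end

theorem mainTheorem11 {k : Type*} {H : Type*} [Field k] [IsAlgClosed k] [CharZero k]
    [Ring H] [HopfAlgebra k H] [IsSemisimpleRing H] :
    IsGreatest {B : Submodule k H | HopfCenter.IsHopfSubalgebra B ∧
        B ≤ Subalgebra.toSubmodule (Subalgebra.center k H)} (HopfCenter.tildeZ k H) ∧
      (∀ N : Submodule k H, HopfCenter.IsLeftCoideal N →
        N ≤ Subalgebra.toSubmodule (Subalgebra.center k H) → N ≤ HopfCenter.tildeZ k H) ∧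
      (∀ N : Submodule k H, HopfCenter.IsRightCoideal N →
        N ≤ Subalgebra.toSubmodule (Subalgebra.center k H) → N ≤ HopfCenter.tildeZ k H) := by
  rw [HopfCenter.tildeZ_eq_centralComul]
  refine ⟨⟨⟨HopfCenter.isHopfSubalgebra_centralComul k H,
    HopfCenter.centralComul_le_center k H⟩, ?_⟩,
    fun _ => HopfCenter.le_centralComul_of_isLeftCoideal,
    fun _ => HopfCenter.le_centralComul_of_isRightCoideal⟩
  rintro B ⟨hB, hc⟩
  exact HopfCenter.le_centralComul_of_isLeftCoideal
    (fun x hx => HopfCenter.tensorSub_mono le_top le_rfl (hB.comul_mem hx)) hc
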